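/- Let $M$ be a smooth manifold (finite-dimensional, Hausdorff, second countable, without boundary), let $V\to M$ be a smooth real vector bundle of finite rank, and let $\Gamma(V)$ be the vector space of smooth sections of $V$. Equip $\Gamma(V)$ with its usual Fréchet topology, i.e. the locally convex topology of uniform convergence of all derivatives on compact sets: it is defined by the seminorms $s\mapsto \sup_{y\in K}\|D^k s_{\mathrm{loc}}(y)\|$, where $k\in\mathbb N$, $s_{\mathrm{loc}}$ is the local representative of $s$ in a chart of $M$ and a local trivialization of $V$, and $K$ is a compact set of coordinates of points in the common domain of the chart and the trivialization. Then the diffeology $\sigma_\infty$ induced by this Fréchet structure coincides with the standard functional diffeology on $\Gamma(V)$. Here the plots of the $\sigma_\infty$-diffeology are the maps $p\colon U\to\Gamma(V)$, with $U\subseteq\mathbb R^n$ open and $n\in\mathbb N$, such that $l\circ p\colon U\to\mathbb R$ is smooth for every continuous linear functional $l$ on $\Gamma(V)$; and the standard functional diffeology is the subspace diffeology inherited from $C^\infty(M,V)$, so its plots are the maps $p\colon U\to\Gamma(V)$ whose transpose $U\times M\to V$, $(u,x)\mapsto p(u)(x)$, is smooth. Explicitly: for every $n\in\mathbb N$, every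 open $U\subseteq\mathbb R^n$ and every map $p\colon U\to\Gamma(V)$, the function $l\circ p$ is smooth for all continuous linear $l\colon\Gamma(V)\to\mathbb R$ if and only if the map $U\times M\to V$, $(u,x)\mapsto p(u)(x)$, is smooth. -/

import Mathlib

open Bundle Set Topology
open scoped Manifold ContDiff

noncomputable section

namespace SectionDiffeology

/-! ### Diffeologies: manifolds, products, mapping spaces, subspaces -/

section General

open Diffeology

/-- The diffeology of a smooth manifold `N`: the plots are the usual smooth maps into `N`. -/
@[reducible]
def manifoldDiffeology {E H : Type*} [NormedAddCommGroup E] [NormedSpace ℝ E] [TopologicalSpace H]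
    (I : ModelWithCorners ℝ E H) (N : Type*) [TopologicalSpace N] [ChartedSpace H N] :
    DiffeologicalSpace N :=
  .ofCorePlotsOn
    { isPlotOn := fun {n} {u} _ p ↦ ContMDiffOn 𝓘(ℝ, EuclideanSpace ℝ (Fin n)) I ∞ p u
      isPlotOn_congr := fun _ _ _ h ↦ contMDiffOn_congr h
      isPlot := fun {n} p ↦ ContMDiff 𝓘(ℝ, EuclideanSpace ℝ (Fin n)) I ∞ p
      isPlotOn_univ := contMDiffOn_univ
      isPlot_const := fun _ ↦ contMDiff_const
      isPlotOn_reparam := fun _ _ _ h hp hf ↦ hp.comp hf.contMDiffOn h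
      locality := fun _ _ h x hx ↦ by
        obtain ⟨v, hv, hxv, hp⟩ := h x hx
        exact ((hp x hxv).contMDiffAt (hv.mem_nhds hxv)).contMDiffWithinAt }

/-- The product diffeology on `X × Y`: the plots are the maps both of whose components are
plots. -/
@[reducible]
def prodDiffeology (X Y : Type*) [DiffeologicalSpace X] [DiffeologicalSpace Y] :
    DiffeologicalSpace (X × Y) where
  plots n := {p | IsPlot (fun t ↦ (p t).1) ∧ IsPlot (fun t ↦ (p t).2)}
  constant_plots _ := ⟨isPlot_const, isPlot_const⟩
  plot_reparam hp hf := ⟨isPlot_reparam hp.1 hf, isPlot_reparam hp.2 hf⟩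
  locality hp := by
    refine ⟨DiffeologicalSpace.locality fun x ↦ ?_, DiffeologicalSpace.locality fun x ↦ ?_⟩
    · obtain ⟨u, hu, hxu, h⟩ := hp x
      exact ⟨u, hu, hxu, fun hf hf' ↦ (h hf hf').1⟩
    · obtain ⟨u, hu, hxu, h⟩ := hp x
      exact ⟨u, hu, hxu, fun hf hf' ↦ (h hf hf').2⟩

/-- `C^∞(X, Y)`, the set of smooth maps between the diffeological spaces `X` and `Y`. -/
abbrev SmoothMaps (X Y : Type*) [DiffeologicalSpace X] [DiffeologicalSpace Y] : Type _ :=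
  {f : X → Y // DSmooth f}

/-- Smoothness of the transpose `(u, x) ↦ p u x` of `p : ℝⁿ → C^∞(X, Y)`, where `ℝⁿ × X` carries the
product diffeology. -/
def SmoothTranspose {X Y : Type*} [DiffeologicalSpace X] [DiffeologicalSpace Y] {n : ℕ}
    (p : EuclideanSpace ℝ (Fin n) → SmoothMaps X Y) : Prop :=
  letI := prodDiffeology (EuclideanSpace ℝ (Fin n)) X
  DSmooth (fun z : EuclideanSpace ℝ (Fin n) × X ↦ (p z.1).1 z.2)

/-- The standard functional diffeology on `C^∞(X, Y)`: the plots are the maps with smooth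
transpose. -/
@[reducible]
def functionalDiffeology (X Y : Type*) [DiffeologicalSpace X] [DiffeologicalSpace Y] :
    DiffeologicalSpace (SmoothMaps X Y) where
  plots n := {p | SmoothTranspose p}
  constant_plots f := fun n q hq ↦ f.2 n _ hq.2
  plot_reparam {n m p f} hp hf := fun k q hq ↦
    hp k (fun t ↦ (f (q t).1, (q t).2)) ⟨hf.dSmooth _ _ hq.1, hq.2⟩
  locality {n p} hp := fun k q hq ↦ by
    have hq₁ : ContDiff ℝ ∞ (fun t ↦ (q t).1) := hq.1.contDiff
    refine DiffeologicalSpace.locality fun x ↦ ?_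
    obtain ⟨u, hu, hxu, h⟩ := hp (q x).1
    refine ⟨(fun t ↦ (q t).1) ⁻¹' u, hu.preimage hq₁.continuous, hxu, fun {m f} hfu hf ↦ ?_⟩
    exact h (f := fun s ↦ (q (f s)).1) hfu (hq₁.comp hf) m (fun s ↦ (s, (q (f s)).2))
      ⟨isPlot_id', isPlot_reparam hq.2 hf⟩

/-- The diffeology induced on `S` by a map `i : S → X` into a diffeological space: `p` is a plot iff
`i ∘ p` is one. When `i` is injective, this is the subspace diffeology of `S ≅ i(S) ⊆ X`. -/
@[reducible]
def inducedDiffeology {S X : Type*} (d : DiffeologicalSpace X) (i : S → X) :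
    DiffeologicalSpace S where
  plots n := {p | IsPlot (i ∘ p)}
  constant_plots _ := isPlot_const
  plot_reparam hp hf := isPlot_reparam hp hf
  locality hp := DiffeologicalSpace.locality hp

/-- The diffeology `σ_∞(E)` of a locally convex space `E`: a map `p` into `E` is a plot iff `l ∘ p`
is smooth for every continuous linear functional `l` on `E`. -/
@[reducible]
def sigmaInfty (E : Type*) [AddCommGroup E] [Module ℝ E] [TopologicalSpace E]
    [IsTopologicalAddGroup E] [ContinuousSMul ℝ E] [LocallyConvexSpace ℝ E] :
    DiffeologicalSpace E :=
  .ofCorePlotsOn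
    { isPlotOn := fun {_ u} _ p ↦ ∀ l : E →L[ℝ] ℝ, ContDiffOn ℝ ∞ (fun t ↦ l (p t)) u
      isPlotOn_congr := fun _ _ _ h ↦
        forall_congr' fun l ↦ contDiffOn_congr fun _ hx ↦ congrArg l (h hx)
      isPlot := fun p ↦ ∀ l : E →L[ℝ] ℝ, ContDiff ℝ ∞ (fun t ↦ l (p t))
      isPlotOn_univ := forall_congr' fun _ ↦ contDiffOn_univ
      isPlot_const := fun _ _ ↦ contDiff_const
      isPlotOn_reparam := fun _ _ _ h hp hf l ↦ (hp l).comp hf h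
      locality := fun _ _ h l x hx ↦ by
        obtain ⟨v, hv, hxv, hp⟩ := h x hx
        exact ((hp l x hxv).contDiffAt (hv.mem_nhds hxv)).contDiffWithinAt }

end General

/-! ### Sections of a smooth vector bundle -/

section Sections

variable {E H : Type*} [NormedAddCommGroup E] [NormedSpace ℝ E] [TopologicalSpace H]
  (I : ModelWithCorners ℝ E H)
  {M : Type*} [TopologicalSpace M] [ChartedSpace H M]
  (F : Type*) [NormedAddCommGroup F] [NormedSpace ℝ F]
  (V : M → Type*) [TopologicalSpace (TotalSpace F V)] [∀ x, TopologicalSpace (V x)]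
  [FiberBundle F V]

/-- A smooth section is a smooth map of diffeological spaces from `M` to the total space. -/
theorem dSmooth_section (s : Cₛ^∞⟮I; F, V⟯) :
    letI := manifoldDiffeology I M
    letI := manifoldDiffeology (I.prod 𝓘(ℝ, F)) (TotalSpace F V)
    Diffeology.DSmooth (fun x : M ↦ TotalSpace.mk' F x (s x)) :=
  fun _ _ hp ↦ s.contMDiff.comp hp

/-- The standard functional diffeology on `Γ(V)`: the subspace diffeology inherited from the
functional diffeology on `C^∞(M, V)`, where `V` stands for the total space. -/
@[reducible]
def functionalDiffeologyOnSections : DiffeologicalSpace Cₛ^∞⟮I; F, V⟯ :=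
  letI := manifoldDiffeology I M
  letI := manifoldDiffeology (I.prod 𝓘(ℝ, F)) (TotalSpace F V)
  inducedDiffeology (functionalDiffeology M (TotalSpace F V))
    (fun s ↦ ⟨fun x ↦ TotalSpace.mk' F x (s x), dSmooth_section I F V s⟩)

/-- The local representative of a section `s` in the chart and the trivialization around `x₀`, as a
map from (the chart's target in) the model space `E` to the model fiber `F`. It is only meaningful
on the set `localDomain` below. -/
def localRep (x₀ : M) (s : ∀ x, V x) (y : E) : F :=
  (trivializationAt F V x₀ ⟨(extChartAt I x₀).symm y, s ((extChartAt I x₀).symm y)⟩).2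

/-- The set of coordinates `y` of those points that lie both in the domain of the chart around `x₀`
and in the base set of the trivialization around `x₀`. -/
def localDomain (x₀ : M) : Set E :=
  (extChartAt I x₀).target ∩ (extChartAt I x₀).symm ⁻¹' (trivializationAt F V x₀).baseSet

/-- The data indexing the seminorms of the `C^∞`-topology on `Γ(V)`: a base point `x₀` selecting a
chart of `M` and a trivialization of `V`, a compact set `K` of coordinates in the common domain of
the two, and the order `k` of the derivatives that are measured. -/
structure SeminormIndex where
  x₀ : M
  K : Set E
  isCompact : IsCompact K
  subset : K ⊆ localDomain I F V x₀
  k : ℕ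

theorem isOpen_localDomain [I.Boundaryless] (x₀ : M) : IsOpen (localDomain I F V x₀) :=
  (continuousOn_extChartAt_symm x₀).isOpen_inter_preimage (isOpen_extChartAt_target x₀)
    (trivializationAt F V x₀).open_baseSet

variable [∀ x, AddCommGroup (V x)] [∀ x, Module ℝ (V x)] [VectorBundle ℝ F V]

theorem localRep_add (x₀ : M) (s t : Cₛ^∞⟮I; F, V⟯) :
    EqOn (localRep I F V x₀ ⇑(s + t)) (localRep I F V x₀ s + localRep I F V x₀ t)
      (localDomain I F V x₀) :=
  fun _ hy ↦ ((trivializationAt F V x₀).linear ℝ hy.2).1 _ _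

theorem localRep_smul (x₀ : M) (c : ℝ) (s : Cₛ^∞⟮I; F, V⟯) :
    EqOn (localRep I F V x₀ ⇑(c • s)) (c • localRep I F V x₀ s) (localDomain I F V x₀) :=
  fun _ hy ↦ ((trivializationAt F V x₀).linear ℝ hy.2).2 _ _

variable [IsManifold I ∞ M] [ContMDiffVectorBundle ∞ F V I]

theorem contDiffOn_localRep (x₀ : M) (s : Cₛ^∞⟮I; F, V⟯) :
    ContDiffOn ℝ ∞ (localRep I F V x₀ s) (localDomain I F V x₀) := by
  have h₁ : ContMDiffOn I 𝓘(ℝ, F) ∞ (fun x ↦ (trivializationAt F V x₀ ⟨x, s x⟩).2)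
      (trivializationAt F V x₀).baseSet :=
    (((trivializationAt F V x₀).contMDiffOn_iff (IB := I) (n := ∞)
      (fun x hx ↦ (trivializationAt F V x₀).mem_source.2 hx)).1
        (s.contMDiff.contMDiffOn (s := (trivializationAt F V x₀).baseSet))).2
  exact (h₁.comp ((contMDiffOn_extChartAt_symm x₀).mono inter_subset_left)
    fun y hy ↦ hy.2).contDiffOn

variable [I.Boundaryless]

theorem bddAbove_iteratedFDeriv_localRep (x₀ : M) {K : Set E} (hK : IsCompact K)
    (hKD : K ⊆ localDomain I F V x₀) (k : ℕ) (s : Cₛ^∞⟮I; F, V⟯) :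
    BddAbove (range fun y : K ↦ ‖iteratedFDeriv ℝ k (localRep I F V x₀ s) y‖) := by
  have hD := isOpen_localDomain I F V x₀
  have hc : ContinuousOn (iteratedFDeriv ℝ k (localRep I F V x₀ s)) (localDomain I F V x₀) :=
    ((contDiffOn_localRep I F V x₀ s).continuousOn_iteratedFDerivWithin
      (by exact_mod_cast le_top) hD.uniqueDiffOn).congr
        fun y hy ↦ (iteratedFDerivWithin_of_isOpen k hD hy).symm
  have := (hK.image_of_continuousOn (hc.mono hKD).norm).bddAbove
  rwa [image_eq_range] at this

/-- The seminorms `s ↦ sup_{y ∈ K} ‖Dᵏ s_{x₀}(y)‖`, with `s_{x₀}` the local representative of the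
section `s` in the chart and the trivialization around `x₀`. -/
def sectionSeminorm : SeminormFamily ℝ Cₛ^∞⟮I; F, V⟯ (SeminormIndex I F V) := fun i ↦
  Seminorm.of (fun s ↦ ⨆ y : i.K, ‖iteratedFDeriv ℝ i.k (localRep I F V i.x₀ s) y‖)
    (fun s t ↦ by
      have hD := isOpen_localDomain I F V i.x₀
      refine Real.iSup_le (fun y ↦ ?_) (add_nonneg (Real.iSup_nonneg fun _ ↦ norm_nonneg _)
        (Real.iSup_nonneg fun _ ↦ norm_nonneg _))
      have hy := hD.mem_nhds (i.subset y.2)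
      have hs := ((contDiffOn_localRep I F V i.x₀ s).contDiffAt hy).of_le
        (m := (i.k : ℕ∞ω)) (by exact_mod_cast le_top)
      have ht := ((contDiffOn_localRep I F V i.x₀ t).contDiffAt hy).of_le
        (m := (i.k : ℕ∞ω)) (by exact_mod_cast le_top)
      have h : iteratedFDeriv ℝ i.k (localRep I F V i.x₀ ⇑(s + t)) y =
          iteratedFDeriv ℝ i.k (localRep I F V i.x₀ s) y +
            iteratedFDeriv ℝ i.k (localRep I F V i.x₀ t) y := by
        rw [← iteratedFDeriv_add_apply hs ht]
        exact (Filter.EventuallyEq.iteratedFDeriv ℝ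
          ((localRep_add I F V i.x₀ s t).eventuallyEq_of_mem hy) i.k).eq_of_nhds
      rw [h]
      exact (norm_add_le _ _).trans (add_le_add
        (le_ciSup (bddAbove_iteratedFDeriv_localRep I F V i.x₀ i.isCompact i.subset i.k s) y)
        (le_ciSup (bddAbove_iteratedFDeriv_localRep I F V i.x₀ i.isCompact i.subset i.k t) y)))
    (fun c s ↦ by
      have hD := isOpen_localDomain I F V i.x₀
      rw [Real.mul_iSup_of_nonneg (norm_nonneg c)]
      congr 1
      funext y
      have hy := hD.mem_nhds (i.subset y.2)
      have hs := ((contDiffOn_localRep I F V i.x₀ s).contDiffAt hy).of_le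
        (m := (i.k : ℕ∞ω)) (by exact_mod_cast le_top)
      have h : iteratedFDeriv ℝ i.k (localRep I F V i.x₀ ⇑(c • s)) y =
          c • iteratedFDeriv ℝ i.k (localRep I F V i.x₀ s) y := by
        rw [← iteratedFDeriv_const_smul_apply hs]
        exact (Filter.EventuallyEq.iteratedFDeriv ℝ
          ((localRep_smul I F V i.x₀ c s).eventuallyEq_of_mem hy) i.k).eq_of_nhds
      rw [h, norm_smul])

variable {I F V}

/-- The usual Fréchet topology on `Γ(V)`, that is, the `C^∞`-topology of uniform convergence on
compact sets of all derivatives in charts and trivializations. It is the locally convex topology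
defined by the seminorms `sectionSeminorm`. -/
instance frechetTopology : TopologicalSpace Cₛ^∞⟮I; F, V⟯ :=
  (sectionSeminorm I F V).moduleFilterBasis.topology

variable (I F V) in
theorem withSeminorms_section : WithSeminorms (sectionSeminorm I F V) := ⟨rfl⟩

instance : IsTopologicalAddGroup Cₛ^∞⟮I; F, V⟯ := (withSeminorms_section I F V).topologicalAddGroup

instance : ContinuousSMul ℝ Cₛ^∞⟮I; F, V⟯ := (withSeminorms_section I F V).continuousSMul

instance : LocallyConvexSpace ℝ Cₛ^∞⟮I; F, V⟯ := (withSeminorms_section I F V).toLocallyConvexSpace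

end Sections

end SectionDiffeology

end

/-!
Both notions of plot are compared with the smoothness, for each `x₀`, of the local representatives
`(u, y) ↦ (p u)_{x₀}(y)` on `U × localDomain x₀`. For the transpose this is the definition of
smoothness in charts (`contMDiffOn_transpose_iff_localRep`), and a map out of `ℝⁿ × M` is smooth
along all plots iff it is smooth, since `ℝⁿ × M` is locally the image of a plot with smooth inverse
(`dSmooth_prod_iff_contMDiff`).

*From functionals to local representatives.* Fix a closed ball in `localDomain x₀` and an order `m`.
Let `q` be the maximum of the seminorms of order at most `m + 1` on that ball, `N` the normed space
obtained from `(Γ(V), q)`, and `X` its dual. Every element of `X` is a continuous functional on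
`Γ(V)`, so `u ↦ (l ↦ l (p u))` is a map from `U` to the dual of the Banach space `X` which is smooth
for the strong topology; by Banach-Steinhaus it is then smooth in norm
(`contDiffOn_clm_of_apply`). On the other hand, the evaluations `δ_y : s ↦ s_{x₀}(y)` depend on `y`
in a `C^m` way as operators on `N`, because `q` bounds one derivative more
(`contDiffOn_clm_of_iteratedFDeriv_apply_bound`). A component of the local representative at `(u, y)`
is the pairing of these two maps, hence `C^m` in `(u, y)` jointly
(`contDiffOn_uncurry_of_seminorm`); no mixed partial derivative has to be discussed.

*From local representatives to functionals.* A continuous functional `l` is bounded by finitely many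
seminorms, so by Hahn-Banach it factors through the restrictions `s ↦ Dᵏ s_{x₀}|_K` with values in
the Banach spaces `C(K, E [×k]→L[ℝ] F)` (`contDiffOn_of_bound_by_norm`). If the local
representatives of `p` are jointly smooth, then so are their derivatives in `y`, and a jointly smooth
map on `U × K` is smooth as a map from `U` to the space of continuous functions on the compact `K`
(`contDiffOn_continuousMap_of_uncurry`).

In both directions Fréchet derivatives in a space of operators or of continuous functions are found
by testing on a norming family of evaluations (`hasFDerivAt_of_norming_family`).
-/

universe u v

/-! ### Smoothness of operator-valued maps in the strong and in the norm topology -/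

/-- A map into a normed space is differentiable with derivative `f'` if `f'` is continuous and the
derivative is correct after composition with each member of a norming family of linear maps `e i`
of norm at most `1`: the mean value inequality for `e i ∘ f` gives a remainder that is uniform in `i`. -/
theorem hasFDerivAt_of_norming_family {P Z ι : Type*} {G : ι → Type*}
    [NormedAddCommGroup P] [NormedSpace ℝ P] [NormedAddCommGroup Z] [NormedSpace ℝ Z]
    [∀ i, NormedAddCommGroup (G i)] [∀ i, NormedSpace ℝ (G i)]
    (e : ∀ i, Z →L[ℝ] G i) (he : ∀ i z, ‖e i z‖ ≤ ‖z‖)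
    (hnorm : ∀ z c, 0 ≤ c → (∀ i, ‖e i z‖ ≤ c) → ‖z‖ ≤ c)
    {U : Set P} (hU : IsOpen U) {f : P → Z} {f' : P → P →L[ℝ] Z} (hf' : ContinuousOn f' U)
    (hf : ∀ i, ∀ u ∈ U, HasFDerivAt (fun v ↦ e i (f v)) (e i ∘L f' u) u) {u : P} (hu : u ∈ U) :
    HasFDerivAt f (f' u) u := by
  rw [hasFDerivAt_iff_isLittleO, Asymptotics.isLittleO_iff]
  intro c hc
  have h1 : ∀ᶠ v in 𝓝 u, v ∈ U ∧ ‖f' v - f' u‖ ≤ c := by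
    refine Filter.Eventually.and (hU.mem_nhds hu) ?_
    have := (hf'.continuousAt (hU.mem_nhds hu)).eventually (Metric.closedBall_mem_nhds (f' u) hc)
    filter_upwards [this] with v hv
    rwa [← dist_eq_norm]
  obtain ⟨r, hr, hball⟩ := Metric.eventually_nhds_iff_ball.1 h1
  filter_upwards [Metric.ball_mem_nhds u hr] with v hv
  refine hnorm _ _ (by positivity) fun i ↦ ?_
  have key := (convex_ball u r).norm_image_sub_le_of_norm_hasFDerivWithin_le'
    (f := fun v ↦ e i (f v)) (f' := fun v ↦ e i ∘L f' v) (φ := e i ∘L f' u) (C := c)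
    (fun w hw ↦ (hf i w (hball w hw).1).hasFDerivWithinAt) (fun w hw ↦ ?_)
    (Metric.mem_ball_self hr) hv
  · simpa [map_sub] using key
  · rw [← ContinuousLinearMap.comp_sub]
    refine (ContinuousLinearMap.opNorm_comp_le _ _).trans ?_
    have : ‖e i‖ ≤ 1 := ContinuousLinearMap.opNorm_le_bound _ zero_le_one (by simpa using he i)
    calc _ ≤ 1 * c := by gcongr; exact (hball w hw).2
      _ = c := one_mul c

/-- A strong derivative that is continuous in norm is a Fréchet derivative in norm. -/
theorem hasFDerivAt_clm_of_apply {P X Y : Type*}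
    [NormedAddCommGroup P] [NormedSpace ℝ P] [NormedAddCommGroup X] [NormedSpace ℝ X]
    [NormedAddCommGroup Y] [NormedSpace ℝ Y]
    {U : Set P} (hU : IsOpen U) {f : P → X →L[ℝ] Y} {f' : P → X →L[ℝ] P →L[ℝ] Y}
    (hf' : ContinuousOn f' U) (hf : ∀ x, ∀ u ∈ U, HasFDerivAt (fun v ↦ f v x) (f' u x) u)
    {u : P} (hu : u ∈ U) : HasFDerivAt f (f' u).flip u := by
  refine hasFDerivAt_of_norming_family (ι := {x : X // ‖x‖ ≤ 1}) (G := fun _ ↦ Y)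
    (fun x ↦ ContinuousLinearMap.apply ℝ Y x.1) (fun x z ↦ ?_) (fun z c hc h ↦ ?_) hU
    (f' := fun u ↦ (f' u).flip) ?_ (fun x u hu ↦ ?_) hu
  · exact (z.le_opNorm x).trans (mul_le_of_le_one_right (norm_nonneg _) x.2)
  · refine ContinuousLinearMap.opNorm_le_of_unit_norm hc fun x hx ↦ ?_
    exact h ⟨x, hx.le⟩
  · exact (ContinuousLinearMap.flipₗᵢ ℝ X P Y).continuous.comp_continuousOn hf'
  · exact hf x u hu

/-- The pointwise derivatives of a strongly differentiable operator-valued map assemble to an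
operator-valued map as soon as they are bounded. -/
theorem exists_strong_fderiv {P X Y : Type*}
    [NormedAddCommGroup P] [NormedSpace ℝ P] [NormedAddCommGroup X] [NormedSpace ℝ X]
    [NormedAddCommGroup Y] [NormedSpace ℝ Y]
    {U : Set P} {f : P → X →L[ℝ] Y}
    (hf : ∀ x, ∀ u ∈ U, DifferentiableAt ℝ (fun v ↦ f v x) u)
    (hb : ∀ u ∈ U, ∃ C : ℝ, ∀ x, ‖fderiv ℝ (fun v ↦ f v x) u‖ ≤ C * ‖x‖) :
    ∃ f' : P → X →L[ℝ] P →L[ℝ] Y, ∀ u ∈ U, ∀ x, f' u x = fderiv ℝ (fun v ↦ f v x) u := by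
  have : ∀ u, ∃ A : X →L[ℝ] P →L[ℝ] Y, u ∈ U → ∀ x, A x = fderiv ℝ (fun v ↦ f v x) u := by
    intro u
    by_cases hu : u ∈ U
    · obtain ⟨C, hC⟩ := hb u hu
      refine ⟨LinearMap.mkContinuous
        { toFun := fun x ↦ fderiv ℝ (fun v ↦ f v x) u
          map_add' := fun x y ↦ ?_
          map_smul' := fun c x ↦ ?_ } C hC, fun _ x ↦ rfl⟩
      · simp only [map_add]
        exact fderiv_fun_add (hf x u hu) (hf y u hu)
      · simp only [map_smul]
        exact fderiv_fun_const_smul (hf x u hu) c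
    · exact ⟨0, fun h ↦ (hu h).elim⟩
  choose f' h using this
  exact ⟨f', h⟩

/-- Uniformly bounded strong derivatives make an operator-valued map Lipschitz in norm. -/
theorem continuousOn_clm_of_fderiv_apply_bound {P X Y : Type*}
    [NormedAddCommGroup P] [NormedSpace ℝ P] [NormedAddCommGroup X] [NormedSpace ℝ X]
    [NormedAddCommGroup Y] [NormedSpace ℝ Y]
    {U : Set P} (hc : Convex ℝ U) {f : P → X →L[ℝ] Y} {C : ℝ}
    (hf : ∀ x, ∀ u ∈ U, DifferentiableAt ℝ (fun v ↦ f v x) u)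
    (hb : ∀ u ∈ U, ∀ x, ‖fderiv ℝ (fun v ↦ f v x) u‖ ≤ C * ‖x‖) : ContinuousOn f U := by
  refine LipschitzOnWith.continuousOn (K := C.toNNReal) (LipschitzOnWith.of_dist_le_mul ?_)
  intro u hu v hv
  rw [dist_eq_norm, dist_eq_norm]
  refine ContinuousLinearMap.opNorm_le_bound _ (by positivity) fun x ↦ ?_
  have := hc.norm_image_sub_le_of_norm_fderiv_le (f := fun v ↦ f v x) (C := C.toNNReal * ‖x‖)
    (fun w hw ↦ hf x w hw) (fun w hw ↦ ?_) hv hu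
  · rw [sub_apply]
    linarith
  · refine (hb w hw x).trans ?_
    gcongr
    exact Real.le_coe_toNNReal C

theorem contDiffOn_clm_flip {𝕜 P X Y : Type*} [NontriviallyNormedField 𝕜]
    [NormedAddCommGroup P] [NormedSpace 𝕜 P] [NormedAddCommGroup X] [NormedSpace 𝕜 X]
    [NormedAddCommGroup Y] [NormedSpace 𝕜 Y] {n : ℕ∞ω} {U : Set P} {f' : P → X →L[𝕜] P →L[𝕜] Y}
    (h : ContDiffOn 𝕜 n f' U) : ContDiffOn 𝕜 n (fun u ↦ (f' u).flip) U := by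
  have := ContDiffOn.continuousLinearMap_comp (F := X →L[𝕜] P →L[𝕜] Y) (G := P →L[𝕜] X →L[𝕜] Y)
    (ContinuousLinearMap.flipₗᵢ 𝕜 X P Y).toContinuousLinearEquiv.toContinuousLinearMap h
  exact this

/-- Version of `contDiffOn_clm_of_iteratedFDeriv_apply_bound` in which the universe of `Y` is large
enough for `P →L[ℝ] Y`, as the induction on `m` requires. -/
theorem contDiffOn_clm_of_iteratedFDeriv_apply_bound_aux
    {P : Type u} {X : Type*} {Y : Type (max u v)}
    [NormedAddCommGroup P] [NormedSpace ℝ P] [NormedAddCommGroup X] [NormedSpace ℝ X]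
    [NormedAddCommGroup Y] [NormedSpace ℝ Y]
    {U : Set P} (hU : IsOpen U) (hc : Convex ℝ U) (m : ℕ) {f : P → X →L[ℝ] Y} {C : ℝ}
    (hf : ∀ x, ContDiffOn ℝ ∞ (fun v ↦ f v x) U)
    (hb : ∀ k ≤ m + 1, ∀ u ∈ U, ∀ x, ‖iteratedFDeriv ℝ k (fun v ↦ f v x) u‖ ≤ C * ‖x‖) :
    ContDiffOn ℝ m f U := by
  have hdiff : ∀ x, ∀ u ∈ U, DifferentiableAt ℝ (fun v ↦ f v x) u := fun x u hu ↦
    ((hf x).contDiffAt (hU.mem_nhds hu)).differentiableAt (by simp)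
  have hb1 : ∀ u ∈ U, ∀ x, ‖fderiv ℝ (fun v ↦ f v x) u‖ ≤ C * ‖x‖ := fun u hu x ↦ by
    rw [← norm_iteratedFDeriv_one]
    exact hb 1 (by omega) u hu x
  induction m generalizing Y with
  | zero =>
    rw [Nat.cast_zero, contDiffOn_zero]
    exact continuousOn_clm_of_fderiv_apply_bound hc hdiff hb1
  | succ m ih =>
    obtain ⟨f', hf'⟩ := exists_strong_fderiv hdiff fun u hu ↦ ⟨C, hb1 u hu⟩
    have hev : ∀ x, ∀ u ∈ U, (fun v ↦ f' v x) =ᶠ[𝓝 u] fderiv ℝ (fun v ↦ f v x) := fun x u hu ↦ by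
      filter_upwards [hU.mem_nhds hu] with v hv using hf' v hv x
    have hsm : ∀ x, ContDiffOn ℝ ∞ (fun v ↦ f' v x) U := fun x ↦
      ((hf x).fderiv_of_isOpen hU (m := ∞) (by simp)).congr fun v hv ↦ hf' v hv x
    have hbd : ∀ k ≤ m + 1, ∀ u ∈ U, ∀ x,
        ‖iteratedFDeriv ℝ k (fun v ↦ f' v x) u‖ ≤ C * ‖x‖ := fun k hk u hu x ↦ by
      rw [((hev x u hu).iteratedFDeriv ℝ k).eq_of_nhds, norm_iteratedFDeriv_fderiv]
      exact hb (k + 1) (by omega) u hu x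
    have h' : ContDiffOn ℝ m f' U := by
      refine ih hsm hbd (fun x u hu ↦ ((hsm x).contDiffAt (hU.mem_nhds hu)).differentiableAt
        (by simp)) fun u hu x ↦ ?_
      rw [← norm_iteratedFDeriv_one]
      exact hbd 1 (by omega) u hu x
    push_cast
    rw [contDiffOn_succ_iff_hasFDerivWithinAt_of_uniqueDiffOn hU.uniqueDiffOn]
    refine ⟨by simp, fun u ↦ (f' u).flip, ?_, fun u hu ↦ ?_⟩
    · exact contDiffOn_clm_flip h'
    · refine (hasFDerivAt_clm_of_apply hU h'.continuousOn (fun x v hv ↦ ?_) hu).hasFDerivWithinAt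
      rw [hf' v hv x]
      exact (hdiff x v hv).hasFDerivAt

/-- A strongly smooth operator-valued map whose strong derivatives up to order `m + 1` are uniformly
bounded is `C^m` in norm. The extra derivative provides the norm continuity of the last one. -/
theorem contDiffOn_clm_of_iteratedFDeriv_apply_bound {P : Type u} {X : Type*} {Y : Type v}
    [NormedAddCommGroup P] [NormedSpace ℝ P] [NormedAddCommGroup X] [NormedSpace ℝ X]
    [NormedAddCommGroup Y] [NormedSpace ℝ Y]
    {U : Set P} (hU : IsOpen U) (hc : Convex ℝ U) (m : ℕ) {f : P → X →L[ℝ] Y} {C : ℝ}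
    (hf : ∀ x, ContDiffOn ℝ ∞ (fun v ↦ f v x) U)
    (hb : ∀ k ≤ m + 1, ∀ u ∈ U, ∀ x, ‖iteratedFDeriv ℝ k (fun v ↦ f v x) u‖ ≤ C * ‖x‖) :
    ContDiffOn ℝ m f U := by
  let e : ULift.{u} Y ≃ₗᵢ[ℝ] Y := LinearIsometryEquiv.ulift ℝ Y
  have h := contDiffOn_clm_of_iteratedFDeriv_apply_bound_aux.{u, v} hU hc m (C := C)
    (f := fun u ↦ (e.symm.toContinuousLinearEquiv : Y →L[ℝ] ULift.{u} Y) ∘L f u)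
    (fun x ↦ e.symm.contDiff.comp_contDiffOn (hf x)) (fun k hk u hu x ↦ by
      rw [show (fun v ↦ ((e.symm.toContinuousLinearEquiv : Y →L[ℝ] ULift.{u} Y) ∘L f v) x) =
        e.symm ∘ fun v ↦ f v x from rfl, LinearIsometryEquiv.norm_iteratedFDeriv_comp_left]
      exact hb k hk u hu x)
  have h2 := (ContinuousLinearMap.compL ℝ X (ULift.{u} Y) Y
    (e.toContinuousLinearEquiv : ULift.{u} Y →L[ℝ] Y)).contDiff.comp_contDiffOn h
  refine h2.congr fun u _ ↦ ?_
  ext x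
  simp

/-- The first strong derivatives of a strongly `C^1` map on a Banach space are locally uniformly
bounded: apply Banach-Steinhaus to the difference quotients on a ball, which are pointwise bounded
by the mean value inequality. -/
theorem exists_ball_fderiv_apply_bound {P X Y : Type*}
    [NormedAddCommGroup P] [NormedSpace ℝ P] [ProperSpace P]
    [NormedAddCommGroup X] [NormedSpace ℝ X] [CompleteSpace X]
    [NormedAddCommGroup Y] [NormedSpace ℝ Y]
    {U : Set P} (hU : IsOpen U) {f : P → X →L[ℝ] Y} (hf : ∀ x, ContDiffOn ℝ 1 (fun v ↦ f v x) U)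
    {u : P} (hu : u ∈ U) : ∃ r > 0, Metric.ball u r ⊆ U ∧
      ∃ C : ℝ, ∀ v ∈ Metric.ball u r, ∀ x, ‖fderiv ℝ (fun v ↦ f v x) v‖ ≤ C * ‖x‖ := by
  obtain ⟨r, hr, hball⟩ := Metric.nhds_basis_closedBall.mem_iff.1 (hU.mem_nhds hu)
  have hsub := Metric.ball_subset_closedBall.trans hball
  refine ⟨r, hr, hsub, ?_⟩
  have hdiff : ∀ x, ∀ u ∈ U, DifferentiableAt ℝ (fun v ↦ f v x) u := fun x u hu ↦
    ((hf x).contDiffAt (hU.mem_nhds hu)).differentiableAt (by simp)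
  have h1 : ∀ x, ∃ C : ℝ, 0 ≤ C ∧ ∀ v ∈ Metric.ball u r, ∀ w ∈ Metric.ball u r,
      ‖f v x - f w x‖ ≤ C * ‖v - w‖ := fun x ↦ by
    obtain ⟨C, hC⟩ := (isCompact_closedBall u r).exists_bound_of_continuousOn
      (((hf x).continuousOn_fderiv_of_isOpen hU (by simp)).mono hball)
    refine ⟨C, (norm_nonneg _).trans (hC u (Metric.mem_closedBall_self hr.le)),
      fun v hv w hw ↦ ?_⟩
    exact (convex_ball u r).norm_image_sub_le_of_norm_fderiv_le (f := fun v ↦ f v x)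
      (fun z hz ↦ hdiff x z (hsub hz))
      (fun z hz ↦ hC z (Metric.ball_subset_closedBall hz)) hw hv
  obtain ⟨C, hC⟩ := banach_steinhaus
    (g := fun i : Metric.ball u r × Metric.ball u r ↦
      (‖(i.1 : P) - i.2‖)⁻¹ • (f i.1 - f i.2)) (fun x ↦ by
    obtain ⟨C, hC0, hC⟩ := h1 x
    refine ⟨C, fun i ↦ ?_⟩
    rw [smul_apply, norm_smul, norm_inv, norm_norm]
    refine inv_mul_le_of_le_mul₀ (norm_nonneg _) hC0 ?_
    rw [mul_comm]
    exact hC _ i.1.2 _ i.2.2)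
  refine ⟨C, fun v hv x ↦ ?_⟩
  have hC0 : 0 ≤ C := (norm_nonneg _).trans (hC ⟨⟨u, Metric.mem_ball_self hr⟩,
    ⟨u, Metric.mem_ball_self hr⟩⟩)
  have hlip : LipschitzOnWith (C * ‖x‖).toNNReal (fun v ↦ f v x) (Metric.ball u r) := by
    refine LipschitzOnWith.of_dist_le_mul fun v hv w hw ↦ ?_
    rw [Real.coe_toNNReal _ (by positivity), dist_eq_norm, dist_eq_norm]
    rcases eq_or_ne v w with rfl | hvw
    · simp
    have h2 := (((‖v - w‖)⁻¹ • (f v - f w)).le_opNorm x).trans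
      (mul_le_mul_of_nonneg_right (hC ⟨⟨v, hv⟩, ⟨w, hw⟩⟩) (norm_nonneg x))
    rw [smul_apply, norm_smul, norm_inv, norm_norm,
      inv_mul_le_iff₀ (norm_pos_iff.2 (sub_ne_zero.2 hvw)), mul_comm] at h2
    exact h2
  have := norm_fderiv_le_of_lipschitzOn ℝ (Metric.isOpen_ball.mem_nhds hv) hlip
  rwa [Real.coe_toNNReal _ (by positivity)] at this

theorem continuousOn_clm_of_contDiffOn_apply {P X Y : Type*}
    [NormedAddCommGroup P] [NormedSpace ℝ P] [ProperSpace P]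
    [NormedAddCommGroup X] [NormedSpace ℝ X] [CompleteSpace X]
    [NormedAddCommGroup Y] [NormedSpace ℝ Y]
    {U : Set P} (hU : IsOpen U) {f : P → X →L[ℝ] Y} (hf : ∀ x, ContDiffOn ℝ 1 (fun v ↦ f v x) U) :
    ContinuousOn f U := by
  intro u hu
  obtain ⟨r, hr, hsub, C, hC⟩ := exists_ball_fderiv_apply_bound hU hf hu
  exact ((continuousOn_clm_of_fderiv_apply_bound (convex_ball u r)
    (fun x v hv ↦ ((hf x).contDiffAt (hU.mem_nhds (hsub hv))).differentiableAt (by simp))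
    hC).continuousAt (Metric.ball_mem_nhds u hr)).continuousWithinAt

/-- Version of `contDiffOn_clm_of_apply` in which the universe of `Y` is large enough for
`P →L[ℝ] Y`, as the induction on the order requires. -/
theorem contDiffOn_clm_of_apply_aux {P : Type u} {X : Type*} {Y : Type (max u v)}
    [NormedAddCommGroup P] [NormedSpace ℝ P] [ProperSpace P]
    [NormedAddCommGroup X] [NormedSpace ℝ X] [CompleteSpace X]
    [NormedAddCommGroup Y] [NormedSpace ℝ Y]
    {U : Set P} (hU : IsOpen U) {f : P → X →L[ℝ] Y} (hf : ∀ x, ContDiffOn ℝ ∞ (fun v ↦ f v x) U) :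
    ContDiffOn ℝ ∞ f U := by
  rw [contDiffOn_infty]
  intro m
  induction m generalizing Y with
  | zero =>
    rw [Nat.cast_zero, contDiffOn_zero]
    exact continuousOn_clm_of_contDiffOn_apply hU fun x ↦ (hf x).of_le (by simp)
  | succ m ih =>
    have hdiff : ∀ x, ∀ u ∈ U, DifferentiableAt ℝ (fun v ↦ f v x) u := fun x u hu ↦
      ((hf x).contDiffAt (hU.mem_nhds hu)).differentiableAt (by simp)
    obtain ⟨f', hf'⟩ := exists_strong_fderiv hdiff fun u hu ↦ by
      obtain ⟨r, hr, hsub, C, hC⟩ := exists_ball_fderiv_apply_bound hU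
        (fun x ↦ (hf x).of_le (by simp)) hu
      exact ⟨C, hC u (Metric.mem_ball_self hr)⟩
    have hsm : ∀ x, ContDiffOn ℝ ∞ (fun v ↦ f' v x) U := fun x ↦
      ((hf x).fderiv_of_isOpen hU (m := ∞) (by simp)).congr fun v hv ↦ hf' v hv x
    push_cast
    rw [contDiffOn_succ_iff_hasFDerivWithinAt_of_uniqueDiffOn hU.uniqueDiffOn]
    refine ⟨by simp, fun u ↦ (f' u).flip, ?_, fun u hu ↦ ?_⟩
    · exact contDiffOn_clm_flip (ih hsm)
    · refine (hasFDerivAt_clm_of_apply hU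
        (continuousOn_clm_of_contDiffOn_apply hU fun x ↦ (hsm x).of_le (by simp)) (fun x v hv ↦ ?_)
        hu).hasFDerivWithinAt
      rw [hf' v hv x]
      exact (hdiff x v hv).hasFDerivAt

/-- A strongly smooth map into the operators on a Banach space is smooth in norm. -/
theorem contDiffOn_clm_of_apply {P : Type u} {X : Type*} {Y : Type v}
    [NormedAddCommGroup P] [NormedSpace ℝ P] [ProperSpace P]
    [NormedAddCommGroup X] [NormedSpace ℝ X] [CompleteSpace X]
    [NormedAddCommGroup Y] [NormedSpace ℝ Y]
    {U : Set P} (hU : IsOpen U) {f : P → X →L[ℝ] Y} (hf : ∀ x, ContDiffOn ℝ ∞ (fun v ↦ f v x) U) :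
    ContDiffOn ℝ ∞ f U := by
  let e : ULift.{u} Y ≃ₗᵢ[ℝ] Y := LinearIsometryEquiv.ulift ℝ Y
  have h := contDiffOn_clm_of_apply_aux.{u, v} hU
    (f := fun u ↦ (e.symm.toContinuousLinearEquiv : Y →L[ℝ] ULift.{u} Y) ∘L f u)
    (fun x ↦ e.symm.contDiff.comp_contDiffOn (hf x))
  have h2 := (ContinuousLinearMap.compL ℝ X (ULift.{u} Y) Y
    (e.toContinuousLinearEquiv : ULift.{u} Y →L[ℝ] Y)).contDiff.comp_contDiffOn h
  refine h2.congr fun u _ ↦ ?_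
  ext x
  simp

/-! ### Joint smoothness from smoothness against functionals, and conversely -/

/-- The case of `contDiffOn_uncurry_of_seminorm` in which the seminorm is a norm. -/
theorem contDiffOn_uncurry_of_normed {N P E F : Type*} [NormedAddCommGroup N] [NormedSpace ℝ N]
    [NormedAddCommGroup P] [NormedSpace ℝ P] [ProperSpace P]
    [NormedAddCommGroup E] [NormedSpace ℝ E]
    [NormedAddCommGroup F] [NormedSpace ℝ F] [FiniteDimensional ℝ F]
    {U : Set P} (hU : IsOpen U) {D : Set E} (hD : IsOpen D) (hDc : Convex ℝ D) (m : ℕ)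
    {p : P → N} (hp : ∀ l : StrongDual ℝ N, ContDiffOn ℝ ∞ (fun u ↦ l (p u)) U)
    {g : N → E → F} (hadd : ∀ s t, ∀ y ∈ D, g (s + t) y = g s y + g t y)
    (hsmul : ∀ (c : ℝ) s, ∀ y ∈ D, g (c • s) y = c • g s y)
    (hg : ∀ s, ContDiffOn ℝ ∞ (g s) D)
    (hb : ∀ k ≤ m + 1, ∀ s, ∀ y ∈ D, ‖iteratedFDeriv ℝ k (g s) y‖ ≤ ‖s‖) :
    ContDiffOn ℝ m (fun z : P × E ↦ g (p z.1) z.2) (U ×ˢ D) := by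
  have hex : ∀ y, ∃ A : N →L[ℝ] F, y ∈ D → ∀ s, A s = g s y := by
    intro y
    by_cases hy : y ∈ D
    · refine ⟨LinearMap.mkContinuous
        { toFun := fun s ↦ g s y
          map_add' := fun s t ↦ hadd s t y hy
          map_smul' := fun c s ↦ hsmul c s y hy } 1 fun s ↦ ?_, fun _ s ↦ rfl⟩
      simpa using hb 0 (by omega) s y hy
    · exact ⟨0, fun h ↦ (hy h).elim⟩
  choose δ hδ using hex
  have hδm : ContDiffOn ℝ m δ D := by
    refine contDiffOn_clm_of_iteratedFDeriv_apply_bound hD hDc m (C := 1)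
      (fun s ↦ (hg s).congr fun y hy ↦ hδ y hy s) fun k hk y hy s ↦ ?_
    have : (fun v ↦ δ v s) =ᶠ[𝓝 y] g s := by
      filter_upwards [hD.mem_nhds hy] with v hv using hδ v hv s
    rw [(this.iteratedFDeriv ℝ k).eq_of_nhds, one_mul]
    exact hb k hk s y hy
  -- The dual of `N` is complete even if `N` is not, so Banach-Steinhaus applies to it.
  have hΨ : ContDiffOn ℝ ∞ (fun u ↦ NormedSpace.inclusionInDoubleDual ℝ N (p u)) U :=
    contDiffOn_clm_of_apply hU hp
  let b := (ContinuousLinearEquiv.ofFinrankEq (𝕜 := ℝ) (E := F)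
    (F := Fin (Module.finrank ℝ F) → ℝ) (by simp))
  rw [← b.comp_contDiffOn_iff, contDiffOn_pi]
  intro i
  let lam : StrongDual ℝ F := (ContinuousLinearMap.proj (R := ℝ) (φ := fun _ ↦ ℝ) i).comp
    (b : F →L[ℝ] Fin (Module.finrank ℝ F) → ℝ)
  have h1 : ContDiffOn ℝ m (fun y ↦ lam ∘L δ y) D := by
    have := ContDiffOn.continuousLinearMap_comp (F := N →L[ℝ] F) (G := N →L[ℝ] ℝ)
      (ContinuousLinearMap.compL ℝ N F ℝ lam) hδm
    exact this
  have h2 : ContDiffOn ℝ m (fun z : P × E ↦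
      NormedSpace.inclusionInDoubleDual ℝ N (p z.1) (lam ∘L δ z.2)) (U ×ˢ D) :=
    ((hΨ.of_le (by exact_mod_cast le_top)).comp contDiffOn_fst fun z hz ↦ hz.1).clm_apply
      (h1.comp contDiffOn_snd fun z hz ↦ hz.2)
  refine h2.congr fun z hz ↦ ?_
  simp [lam, hδ z.2 hz.2]

/-- Let `g : N → (E → F)` be linear over `D`, with derivatives up to order `m + 1` bounded by a
seminorm `q`. If `p : P → N` is smooth against all functionals bounded by `q`, then
`(u, y) ↦ g (p u) y` is `C^m` jointly. The operator of evaluation at `y` is `C^m` in `y`, and its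
pairing with `p u`, seen in the bidual of `N`, is the map in question. -/
theorem contDiffOn_uncurry_of_seminorm {N P E F : Type*} [AddCommGroup N] [Module ℝ N]
    (q : Seminorm ℝ N)
    [NormedAddCommGroup P] [NormedSpace ℝ P] [ProperSpace P]
    [NormedAddCommGroup E] [NormedSpace ℝ E]
    [NormedAddCommGroup F] [NormedSpace ℝ F] [FiniteDimensional ℝ F]
    {U : Set P} (hU : IsOpen U) {D : Set E} (hD : IsOpen D) (hDc : Convex ℝ D) (m : ℕ)
    {p : P → N} (hp : ∀ l : N →ₗ[ℝ] ℝ, (∃ C : ℝ, 0 ≤ C ∧ ∀ s, |l s| ≤ C * q s) →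
      ContDiffOn ℝ ∞ (fun u ↦ l (p u)) U)
    {g : N → E → F} (hadd : ∀ s t, ∀ y ∈ D, g (s + t) y = g s y + g t y)
    (hsmul : ∀ (c : ℝ) s, ∀ y ∈ D, g (c • s) y = c • g s y)
    (hg : ∀ s, ContDiffOn ℝ ∞ (g s) D)
    (hb : ∀ k ≤ m + 1, ∀ s, ∀ y ∈ D, ‖iteratedFDeriv ℝ k (g s) y‖ ≤ q s) :
    ContDiffOn ℝ m (fun z : P × E ↦ g (p z.1) z.2) (U ×ˢ D) := by
  let _ : SeminormedAddCommGroup N := q.toAddGroupSeminorm.toSeminormedAddCommGroup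
  let _ : NormedSpace ℝ N := { norm_smul_le := fun c s ↦ (map_smul_eq_mul q c s).le }
  have hnorm : ∀ s : N, ‖s‖ = q s := fun s ↦ rfl
  -- The values of `g` on `D` descend to the normed space `N` modulo the kernel of `q`.
  have hcongr : ∀ s t, SeparationQuotient.mk s = SeparationQuotient.mk t → ∀ y ∈ D,
      g s y = g t y := by
    intro s t hst y hy
    have h0 : ‖s - t‖ = 0 := by
      rw [← SeparationQuotient.norm_mk, SeparationQuotient.mk_sub, hst, sub_self, norm_zero]
    have h1 := hb 0 (by omega) (s - t) y hy
    rw [← hnorm, h0, norm_iteratedFDeriv_zero, norm_le_zero_iff] at h1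
    have h2 := hadd (s - t) t y hy
    rwa [sub_add_cancel, h1, zero_add] at h2
  have hout : ∀ a : SeparationQuotient N, SeparationQuotient.mk (Quotient.out a) = a :=
    fun a ↦ Quotient.out_eq a
  have := contDiffOn_uncurry_of_normed (N := SeparationQuotient N) hU hD hDc m
    (p := fun u ↦ SeparationQuotient.mk (p u)) (fun l ↦ ?_) (g := fun a ↦ g (Quotient.out a))
    (fun a b y hy ↦ ?_) (fun c a y hy ↦ ?_) (fun a ↦ hg _) (fun k hk a y hy ↦ ?_)
  · refine this.congr fun z hz ↦ hcongr _ _ (hout _).symm _ hz.2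
  · refine hp (l.toLinearMap ∘ₗ (SeparationQuotient.mkCLM ℝ N).toLinearMap)
      ⟨‖l‖, norm_nonneg _, fun s ↦ ?_⟩
    rw [← hnorm, ← SeparationQuotient.norm_mk]
    exact l.le_opNorm _
  · rw [← hadd _ _ y hy]
    exact hcongr _ _ (by simp only [hout, SeparationQuotient.mk_add]) y hy
  · rw [← hsmul _ _ y hy]
    exact hcongr _ _ (by simp only [hout, SeparationQuotient.mk_smul]) y hy
  · rw [← hout a, SeparationQuotient.norm_mk, hnorm, hout a]
    exact hb k hk _ y hy

/-- A functional that is bounded by the norms of finitely many linear maps into normed spaces factors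
continuously through their product: it is well defined and bounded on the range, and extends by
Hahn-Banach. -/
theorem exists_clm_factor {ι N : Type*} [Fintype ι] [AddCommGroup N] [Module ℝ N]
    {B : ι → Type*} [∀ i, NormedAddCommGroup (B i)] [∀ i, NormedSpace ℝ (B i)]
    (T : ∀ i, N →ₗ[ℝ] B i) (l : N →ₗ[ℝ] ℝ) {C : ℝ}
    (hl : ∀ s, |l s| ≤ C * ‖fun i ↦ T i s‖) :
    ∃ L : StrongDual ℝ (∀ i, B i), ∀ s, L (fun i ↦ T i s) = l s := by
  let A : N →ₗ[ℝ] ∀ i, B i := LinearMap.pi T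
  obtain ⟨σ, hσ⟩ := A.rangeRestrict.exists_rightInverse_of_surjective A.range_rangeRestrict
  have hσ' : ∀ b, A (σ b) = b := fun b ↦ congrArg Subtype.val (LinearMap.congr_fun hσ b)
  let l₀ : StrongDual ℝ (LinearMap.range A) := (l ∘ₗ σ).mkContinuous C fun b ↦ by
    refine (hl _).trans (le_of_eq ?_)
    change C * ‖A (σ b)‖ = _
    rw [hσ']
    rfl
  obtain ⟨L, hL, -⟩ := exists_extension_norm_eq _ l₀
  refine ⟨L, fun s ↦ ?_⟩
  have h1 := hL (A.rangeRestrict s)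
  have h2 : l (σ (A.rangeRestrict s) - s) = 0 := by
    have := hl (σ (A.rangeRestrict s) - s)
    change _ ≤ C * ‖A _‖ at this
    rw [map_sub A, hσ', LinearMap.codRestrict_apply, sub_self, norm_zero, mul_zero] at this
    exact abs_nonpos_iff.1 this
  rw [map_sub, sub_eq_zero] at h2
  exact h1.trans h2

/-- Differentiability against a functional `l` follows from that of the components `T i ∘ p`, if `l`
is bounded by their norms. -/
theorem contDiffOn_of_bound_by_norm {ι N P : Type*} [Fintype ι] [AddCommGroup N] [Module ℝ N]
    [NormedAddCommGroup P] [NormedSpace ℝ P]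
    {B : ι → Type*} [∀ i, NormedAddCommGroup (B i)] [∀ i, NormedSpace ℝ (B i)]
    (T : ∀ i, N →ₗ[ℝ] B i) (l : N →ₗ[ℝ] ℝ) {C : ℝ}
    (hl : ∀ s, |l s| ≤ C * ‖fun i ↦ T i s‖) {k : ℕ∞ω} {U : Set P} {p : P → N}
    (hp : ∀ i, ContDiffOn ℝ k (fun u ↦ T i (p u)) U) : ContDiffOn ℝ k (fun u ↦ l (p u)) U := by
  obtain ⟨L, hL⟩ := exists_clm_factor T l hl
  exact (L.contDiff.comp_contDiffOn (contDiffOn_pi.2 hp)).congr fun u _ ↦ (hL (p u)).symm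

/-- The derivatives in the second variable of a jointly smooth map are jointly smooth. -/
theorem contDiffOn_iteratedFDeriv_snd {𝕜 P E G : Type*} [NontriviallyNormedField 𝕜]
    [NormedAddCommGroup P] [NormedSpace 𝕜 P]
    [NormedAddCommGroup E] [NormedSpace 𝕜 E]
    [NormedAddCommGroup G] [NormedSpace 𝕜 G]
    {W : Set (P × E)} (hW : IsOpen W) {f : P → E → G}
    (hf : ContDiffOn 𝕜 ∞ (fun z : P × E ↦ f z.1 z.2) W) (k : ℕ) :
    ContDiffOn 𝕜 ∞ (fun z : P × E ↦ iteratedFDeriv 𝕜 k (f z.1) z.2) W := by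
  induction k with
  | zero =>
    exact (continuousMultilinearCurryFin0 𝕜 E G).symm.contDiff.comp_contDiffOn hf
  | succ k ih =>
    have h' : ContDiffOn 𝕜 ∞ (fun z : P × E ↦ fderiv 𝕜 (iteratedFDeriv 𝕜 k (f z.1)) z.2) W := ?_
    · have := ContDiffOn.continuousLinearMap_comp (F := E →L[𝕜] E [×k]→L[𝕜] G)
        (G := E [×(k + 1)]→L[𝕜] G) (continuousMultilinearCurryLeftEquiv 𝕜
          (fun _ : Fin (k + 1) ↦ E) G).symm.toContinuousLinearEquiv.toContinuousLinearMap h'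
      exact this
    intro z hz
    refine ContDiffAt.contDiffWithinAt ?_
    refine ContDiffAt.fderiv (f := fun z : P × E ↦ iteratedFDeriv 𝕜 k (f z.1)) (n := ∞)
      (x₀ := z) (g := Prod.snd) ?_ contDiffAt_snd (by simp)
    have h1 : ContDiffAt 𝕜 ∞ (fun z : P × E ↦ iteratedFDeriv 𝕜 k (f z.1) z.2)
      ((fun w : (P × E) × E ↦ (w.1.1, w.2)) (z, z.2)) := ih.contDiffAt (hW.mem_nhds hz)
    exact h1.comp (z, z.2) (f := fun w : (P × E) × E ↦ (w.1.1, w.2)) (by fun_prop)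

/-- The continuous linear map `C(K, P →L[𝕜] G) → (P →L[𝕜] C(K, G))` exchanging the arguments. -/
theorem exists_clm_eval_swap (𝕜 P K G : Type*) [NontriviallyNormedField 𝕜]
    [NormedAddCommGroup P] [NormedSpace 𝕜 P] [NormedAddCommGroup G] [NormedSpace 𝕜 G]
    [TopologicalSpace K] [CompactSpace K] :
    ∃ S : C(K, P →L[𝕜] G) →L[𝕜] P →L[𝕜] C(K, G), ∀ a h y, S a h y = a y h := by
  have hA : ∀ a : C(K, P →L[𝕜] G), ∃ A : P →L[𝕜] C(K, G), (∀ h y, A h y = a y h) ∧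
      ‖A‖ ≤ ‖a‖ := by
    intro a
    let A : P →ₗ[𝕜] C(K, G) :=
      { toFun := fun h ↦ ⟨fun y ↦ a y h, by fun_prop⟩
        map_add' := fun _ _ ↦ by ext; simp
        map_smul' := fun _ _ ↦ by ext; simp }
    have hb : ∀ h, ‖A h‖ ≤ ‖a‖ * ‖h‖ := fun h ↦ by
      rw [ContinuousMap.norm_le _ (by positivity)]
      exact fun y ↦ (ContinuousLinearMap.le_opNorm _ _).trans
        (mul_le_mul_of_nonneg_right (a.norm_coe_le_norm y) (norm_nonneg _))
    have ha : 0 ≤ ‖a‖ := norm_nonneg a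
    exact ⟨A.mkContinuous ‖a‖ hb, fun _ _ ↦ rfl, A.mkContinuous_norm_le ha hb⟩
  choose A hA hAn using hA
  let S : C(K, P →L[𝕜] G) →ₗ[𝕜] P →L[𝕜] C(K, G) :=
    { toFun := A
      map_add' := fun a b ↦ by ext h y; simp [hA]
      map_smul' := fun r a ↦ by ext h y; simp [hA] }
  have hS : Continuous S := AddMonoidHomClass.continuous_of_bound S 1
    fun a ↦ (hAn a).trans (one_mul ‖a‖).ge
  exact ⟨⟨S, hS⟩, hA⟩

set_option synthInstance.maxHeartbeats 200000 in
/-- A jointly smooth map `f` yields a smooth map `u ↦ f u ∘ c` into the continuous functions on a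
compact space `K`. The universe of `G` is large enough for `P →L[ℝ] G`, which replaces `G` in the
induction on the order. -/
theorem contDiffOn_continuousMap_of_uncurry {P : Type u} {K E : Type*} {G : Type (max u v)}
    [NormedAddCommGroup P] [NormedSpace ℝ P] [NormedAddCommGroup E] [NormedSpace ℝ E]
    [NormedAddCommGroup G] [NormedSpace ℝ G] [TopologicalSpace K] [CompactSpace K]
    {U : Set P} (hU : IsOpen U) {c : K → E} (hc : Continuous c) {W : Set (P × E)} (hW : IsOpen W)
    (hUW : ∀ u ∈ U, ∀ y, (u, c y) ∈ W)
    {f : P → E → G} (hf : ContDiffOn ℝ ∞ (fun z : P × E ↦ f z.1 z.2) W)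
    {φ : P → C(K, G)} (hφ : ∀ u ∈ U, ∀ y, φ u y = f u (c y)) :
    ContDiffOn ℝ ∞ φ U := by
  rw [contDiffOn_infty]
  intro m
  have hcont : ∀ {Z : Type (max u v)} [NormedAddCommGroup Z] {f : P → E → Z}
      (_ : ContinuousOn (fun z : P × E ↦ f z.1 z.2) W)
      {φ : P → C(K, Z)} (_ : ∀ u ∈ U, ∀ y, φ u y = f u (c y)), ContinuousOn φ U := by
    intro Z _ f hf φ hφ
    rw [continuousOn_iff_continuous_domRestrict]
    refine ContinuousMap.continuous_of_continuous_uncurry _ ?_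
    have h1 : Continuous fun z : U × K ↦ f z.1 (c z.2) :=
      hf.comp_continuous (f := fun z : U × K ↦ ((z.1 : P), c z.2)) (by fun_prop)
        fun z ↦ hUW _ z.1.2 _
    convert! h1 with z
    exact hφ _ z.1.2 _
  induction m generalizing G with
  | zero =>
    rw [Nat.cast_zero, contDiffOn_zero]
    exact hcont hf.continuousOn hφ
  | succ m ih =>
    -- The candidate for the derivative of `φ` is the partial derivative of `f` in `u`.
    let f' : P → E → P →L[ℝ] G := fun u y ↦ fderiv ℝ (fun v ↦ f v y) u
    have hf' : ContDiffOn ℝ ∞ (fun z : P × E ↦ f' z.1 z.2) W := by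
      intro z hz
      refine ContDiffAt.contDiffWithinAt ?_
      refine ContDiffAt.fderiv (f := fun (z : P × E) v ↦ f v z.2) (n := ∞)
        (x₀ := z) (g := Prod.fst) ?_ contDiffAt_fst (by simp)
      have h1 : ContDiffAt ℝ ∞ (fun z : P × E ↦ f z.1 z.2)
        ((fun w : (P × E) × P ↦ (w.2, w.1.2)) (z, z.1)) := hf.contDiffAt (hW.mem_nhds hz)
      exact h1.comp (z, z.1) (f := fun w : (P × E) × P ↦ (w.2, w.1.2)) (by fun_prop)
    have hex : ∀ u, ∃ ψ : C(K, P →L[ℝ] G), u ∈ U → ∀ y, ψ y = f' u (c y) := by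
      intro u
      by_cases hu : u ∈ U
      · refine ⟨⟨fun y ↦ f' u (c y), ?_⟩, fun _ y ↦ rfl⟩
        exact hf'.continuousOn.comp_continuous (f := fun y ↦ (u, c y)) (by fun_prop)
          fun y ↦ hUW u hu y
      · exact ⟨0, fun h ↦ (hu h).elim⟩
    choose ψ hψ using hex
    obtain ⟨S, hS⟩ := exists_clm_eval_swap ℝ P K G
    have hψm := ih hf' (fun u hu y ↦ hψ u hu y)
    push_cast
    rw [contDiffOn_succ_iff_hasFDerivWithinAt_of_uniqueDiffOn hU.uniqueDiffOn]
    have hSψ : ContDiffOn ℝ m (fun u ↦ S (ψ u)) U := by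
      have := ContDiffOn.continuousLinearMap_comp (F := C(K, P →L[ℝ] G))
        (G := P →L[ℝ] C(K, G)) S hψm
      exact this
    refine ⟨by simp, fun u ↦ S (ψ u), hSψ, fun u hu ↦ ?_⟩
    refine (hasFDerivAt_of_norming_family (ι := K) (G := fun _ ↦ G)
      (fun y ↦ ContinuousMap.evalCLM ℝ y) (fun y z ↦ z.norm_coe_le_norm y)
      (fun z r hr h ↦ (ContinuousMap.norm_le _ hr).2 h) hU
      (f' := fun u ↦ S (ψ u)) hSψ.continuousOn (fun y u hu ↦ ?_) hu).hasFDerivWithinAt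
    have h1 : HasFDerivAt (fun v ↦ f v (c y)) (f' u (c y)) u := by
      have h2 : ContDiffAt ℝ ∞ (fun z : P × E ↦ f z.1 z.2) ((fun v : P ↦ (v, c y)) u) :=
        hf.contDiffAt (hW.mem_nhds (hUW u hu y))
      exact ((h2.comp u (f := fun v : P ↦ (v, c y)) (by fun_prop)).differentiableAt
        (by simp)).hasFDerivAt
    have h3 : (ContinuousMap.evalCLM ℝ y : C(K, G) →L[ℝ] G) ∘L S (ψ u) = f' u (c y) := by
      ext h
      exact (hS _ _ _).trans (by rw [hψ u hu y])
    rw [h3]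
    refine h1.congr_of_eventuallyEq ?_
    filter_upwards [hU.mem_nhds hu] with v hv using hφ v hv y

/-! ### Sections of vector bundles and their local representatives -/

section

open SectionDiffeology Diffeology

/-- The transpose of a family of sections is smooth iff all its local representatives are. -/
theorem contMDiffOn_transpose_iff_localRep {P E H F M : Type*}
    [NormedAddCommGroup P] [NormedSpace ℝ P]
    [NormedAddCommGroup E] [NormedSpace ℝ E]
    [TopologicalSpace H] (I : ModelWithCorners ℝ E H) [I.Boundaryless]
    [TopologicalSpace M] [ChartedSpace H M] [IsManifold I ∞ M]
    [NormedAddCommGroup F] [NormedSpace ℝ F]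
    (V : M → Type*) [TopologicalSpace (TotalSpace F V)] [∀ x, TopologicalSpace (V x)]
    [∀ x, AddCommGroup (V x)] [∀ x, Module ℝ (V x)]
    [FiberBundle F V] [VectorBundle ℝ F V] [ContMDiffVectorBundle ∞ F V I]
    {U : Set P} (hU : IsOpen U) (p : P → ∀ x, V x) :
    ContMDiffOn (𝓘(ℝ, P).prod I) (I.prod 𝓘(ℝ, F)) ∞
        (fun z : P × M ↦ TotalSpace.mk' F z.2 (p z.1 z.2)) (U ×ˢ univ) ↔
      ∀ x₀, ContDiffOn ℝ ∞ (fun z : P × E ↦ localRep I F V x₀ (p z.1) z.2)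
        (U ×ˢ localDomain I F V x₀) := by
  constructor
  · intro h x₀
    have h₁ : ContMDiffOn (𝓘(ℝ, P).prod I) 𝓘(ℝ, F) ∞
        (fun z : P × M ↦ (trivializationAt F V x₀ ⟨z.2, p z.1 z.2⟩).2)
        (U ×ˢ (trivializationAt F V x₀).baseSet) :=
      (((trivializationAt F V x₀).contMDiffOn_iff (IB := I) (n := ∞)
        (fun z hz ↦ (trivializationAt F V x₀).mem_source.2 hz.2)).1
          (h.mono (prod_mono_right (subset_univ _)))).2
    have h₂ : ContMDiffOn 𝓘(ℝ, P × E) (𝓘(ℝ, P).prod I) ∞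
        (fun z : P × E ↦ (z.1, (extChartAt I x₀).symm z.2)) (U ×ˢ localDomain I F V x₀) :=
      contDiff_fst.contMDiff.contMDiffOn.prodMk
        ((contMDiffOn_extChartAt_symm x₀).comp contDiff_snd.contMDiff.contMDiffOn
          fun z hz ↦ hz.2.1)
    exact (h₁.comp h₂ fun z hz ↦ ⟨hz.1, hz.2.2⟩).contDiffOn
  · rintro h ⟨u₀, x₀⟩ ⟨hu₀, -⟩
    refine ContMDiffAt.contMDiffWithinAt ?_
    rw [contMDiffAt_totalSpace]
    refine ⟨contMDiffAt_snd, ?_⟩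
    have hmem : extChartAt I x₀ x₀ ∈ localDomain I F V x₀ := by
      refine ⟨mem_extChartAt_target x₀, ?_⟩
      rw [mem_preimage, extChartAt_to_inv]
      exact FiberBundle.mem_baseSet_trivializationAt' x₀
    have h₁ : ContMDiffAt 𝓘(ℝ, P × E) 𝓘(ℝ, F) ∞
        (fun z : P × E ↦ localRep I F V x₀ (p z.1) z.2) (u₀, extChartAt I x₀ x₀) :=
      ((h x₀).contDiffAt ((hU.prod (isOpen_localDomain I F V x₀)).mem_nhds
        ⟨hu₀, hmem⟩)).contMDiffAt
    have h₂ : ContMDiffAt (𝓘(ℝ, P).prod I) 𝓘(ℝ, P × E) ∞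
        (fun z : P × M ↦ (z.1, extChartAt I x₀ z.2)) (u₀, x₀) :=
      contMDiffAt_fst.prodMk_space
        (ContMDiffAt.comp (u₀, x₀) (contMDiffAt_extChartAt (x := x₀)) contMDiffAt_snd)
    refine (ContMDiffAt.comp (u₀, x₀) h₁ h₂).congr_of_eventuallyEq ?_
    have : ∀ᶠ z : P × M in 𝓝 (u₀, x₀), z.2 ∈ (extChartAt I x₀).source :=
      continuousAt_snd.eventually (extChartAt_source_mem_nhds x₀)
    filter_upwards [this] with z hz
    have hz' := (extChartAt I x₀).left_inv hz
    simp only [Function.comp_def, localRep]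
    rw [hz']

/-- On the product of `ℝⁿ` with a manifold, smoothness along all plots of the product diffeology is
smoothness in the sense of manifolds. -/
theorem dSmooth_prod_iff_contMDiff {E H M E' H' N : Type*}
    [NormedAddCommGroup E] [NormedSpace ℝ E] [FiniteDimensional ℝ E]
    [TopologicalSpace H] (I : ModelWithCorners ℝ E H) [I.Boundaryless]
    [TopologicalSpace M] [ChartedSpace H M] [IsManifold I ∞ M]
    [NormedAddCommGroup E'] [NormedSpace ℝ E']
    [TopologicalSpace H'] (J : ModelWithCorners ℝ E' H')
    [TopologicalSpace N] [ChartedSpace H' N]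
    {n : ℕ} (f : EuclideanSpace ℝ (Fin n) × M → N) :
    (letI := manifoldDiffeology I M
     letI := manifoldDiffeology J N
     letI := prodDiffeology (EuclideanSpace ℝ (Fin n)) M
     DSmooth f) ↔ ContMDiff (𝓘(ℝ, EuclideanSpace ℝ (Fin n)).prod I) J ∞ f := by
  constructor
  · rintro h ⟨u₀, x₀⟩
    let d := Module.finrank ℝ E
    let e : E ≃L[ℝ] EuclideanSpace ℝ (Fin d) := toEuclidean
    let c : EuclideanSpace ℝ (Fin (n + d)) ≃L[ℝ]
        EuclideanSpace ℝ (Fin n) × EuclideanSpace ℝ (Fin d) :=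
      ContinuousLinearEquiv.ofFinrankEq (by simp)
    let φ := extChartAt I x₀
    have hopen : IsOpen (e.symm ⁻¹' φ.target) :=
      (isOpen_extChartAt_target (I := I) x₀).preimage e.symm.continuous
    obtain ⟨r, hr, hball⟩ := Metric.isOpen_iff.1 hopen (e (φ x₀))
      (by simp [φ])
    let b := OpenPartialHomeomorph.univBall (e (φ x₀)) r
    have hbt : b.target = Metric.ball (e (φ x₀)) r :=
      OpenPartialHomeomorph.univBall_target _ hr
    have hbs : b.source = univ := OpenPartialHomeomorph.univBall_source _ _
    have hb : ∀ t, e.symm (b t) ∈ φ.target := fun t ↦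
      hball (hbt ▸ b.map_source (hbs ▸ mem_univ t))
    -- A plot covering a neighbourhood of the base point. Plots are defined on all of `ℝᵏ`, so the
    -- inverse of the chart is precomposed with a diffeomorphism from `ℝᵈ` onto a ball.
    let q : EuclideanSpace ℝ (Fin (n + d)) → EuclideanSpace ℝ (Fin n) × M :=
      fun t ↦ ((c t).1, φ.symm (e.symm (b (c t).2)))
    have hbsm : ContDiff ℝ ∞ b := OpenPartialHomeomorph.contDiff_univBall
    have hq₁ : ContDiff ℝ ∞ fun t ↦ (c t).1 := contDiff_fst.comp c.contDiff
    have hq₂ : ContMDiff 𝓘(ℝ, EuclideanSpace ℝ (Fin (n + d))) I ∞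
        fun t ↦ φ.symm (e.symm (b (c t).2)) := by
      have h1 : ContDiff ℝ ∞ fun t ↦ e.symm (b (c t).2) :=
        e.symm.contDiff.comp (hbsm.comp (contDiff_snd.comp c.contDiff))
      exact (contMDiffOn_extChartAt_symm x₀).comp_contMDiff h1.contMDiff fun t ↦ hb _
    have hfq : ContMDiff 𝓘(ℝ, EuclideanSpace ℝ (Fin (n + d))) J ∞ (f ∘ q) :=
      h (n + d) q ⟨hq₁, hq₂⟩
    -- The plot has a smooth local inverse, so `f` is smooth because `f ∘ q` is.
    have h₁ : ContMDiffAt I 𝓘(ℝ, EuclideanSpace ℝ (Fin d)) ∞ (fun x ↦ b.symm (e (φ x))) x₀ := by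
      have h2 : ContMDiffAt 𝓘(ℝ, E) 𝓘(ℝ, EuclideanSpace ℝ (Fin d)) ∞ (fun y ↦ b.symm (e y))
          (φ x₀) := by
        refine ContDiffAt.contMDiffAt (ContDiffAt.comp _ ?_ e.contDiff.contDiffAt)
        exact OpenPartialHomeomorph.contDiffOn_univBall_symm.contDiffAt (Metric.ball_mem_nhds _ hr)
      exact ContMDiffAt.comp x₀ (g := fun y ↦ b.symm (e y)) (f := φ) h2
        (contMDiffAt_extChartAt (x := x₀))
    have h₂ : ContMDiffAt (𝓘(ℝ, EuclideanSpace ℝ (Fin n)).prod I)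
        𝓘(ℝ, EuclideanSpace ℝ (Fin (n + d))) ∞
        (fun z : EuclideanSpace ℝ (Fin n) × M ↦ c.symm (z.1, b.symm (e (φ z.2)))) (u₀, x₀) :=
      c.symm.contDiff.contMDiff.contMDiffAt.comp (u₀, x₀)
        (contMDiffAt_fst.prodMk_space (ContMDiffAt.comp (u₀, x₀) (g := fun x ↦ b.symm (e (φ x)))
          (f := Prod.snd) h₁ contMDiffAt_snd))
    refine (hfq.contMDiffAt.comp (u₀, x₀) h₂).congr_of_eventuallyEq ?_
    have h3 : ∀ᶠ x in 𝓝 x₀, e (φ x) ∈ b.target :=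
      (e.continuous.continuousAt.comp (continuousAt_extChartAt x₀)).eventually
        (hbt ▸ Metric.ball_mem_nhds _ hr)
    have h5 : ∀ᶠ x in 𝓝 x₀, x ∈ φ.source ∧ e (φ x) ∈ b.target :=
      Filter.Eventually.and (extChartAt_source_mem_nhds x₀) h3
    have hsnd : Filter.Tendsto (Prod.snd : EuclideanSpace ℝ (Fin n) × M → M)
        (𝓝 (u₀, x₀)) (𝓝 x₀) := continuousAt_snd
    filter_upwards [hsnd.eventually h5] with z hz
    simp only [Function.comp_def, q, c.apply_symm_apply, b.right_inv hz.2, e.symm_apply_apply,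
      φ.left_inv hz.1]
  · intro h k q hq
    have h₁ : ContDiff ℝ ∞ fun t ↦ (q t).1 := hq.1
    have h₂ : ContMDiff 𝓘(ℝ, EuclideanSpace ℝ (Fin k)) I ∞ fun t ↦ (q t).2 := hq.2
    exact h.comp (h₁.contMDiff.prodMk h₂)

section

variable {E H F M : Type*}
    [NormedAddCommGroup E] [NormedSpace ℝ E]
    [TopologicalSpace H] (I : ModelWithCorners ℝ E H) [I.Boundaryless]
    [TopologicalSpace M] [ChartedSpace H M] [IsManifold I ∞ M]
    [NormedAddCommGroup F] [NormedSpace ℝ F]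
    (V : M → Type*) [TopologicalSpace (TotalSpace F V)] [∀ x, TopologicalSpace (V x)]
    [∀ x, AddCommGroup (V x)] [∀ x, Module ℝ (V x)]
    [FiberBundle F V] [VectorBundle ℝ F V] [ContMDiffVectorBundle ∞ F V I]

/-- A family of sections that is smooth against all continuous functionals has jointly smooth local
representatives. -/
theorem contDiffOn_localRep_of_contDiffOn_functional [FiniteDimensional ℝ E]
    [FiniteDimensional ℝ F] {n : ℕ}
    {U : Set (EuclideanSpace ℝ (Fin n))} (hU : IsOpen U)
    {p : EuclideanSpace ℝ (Fin n) → Cₛ^∞⟮I; F, V⟯}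
    (hp : ∀ l : Cₛ^∞⟮I; F, V⟯ →L[ℝ] ℝ, ContDiffOn ℝ ∞ (fun u ↦ l (p u)) U) (x₀ : M) :
    ContDiffOn ℝ ∞ (fun z : EuclideanSpace ℝ (Fin n) × E ↦ localRep I F V x₀ (p z.1) z.2)
      (U ×ˢ localDomain I F V x₀) := by
  classical
  rw [contDiffOn_infty]
  rintro m ⟨u₀, y₀⟩ ⟨hu₀, hy₀⟩
  have hD := isOpen_localDomain I F V x₀
  obtain ⟨r, hr, hball⟩ := Metric.nhds_basis_closedBall.mem_iff.1 (hD.mem_nhds hy₀)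
  have hsub : Metric.ball y₀ r ⊆ localDomain I F V x₀ := Metric.ball_subset_closedBall.trans hball
  have : ProperSpace E := FiniteDimensional.proper ℝ E
  -- To obtain order `m`, functionals that see the derivatives up to order `m + 1` are used.
  let i : ℕ → SeminormIndex I F V := fun k ↦
    ⟨x₀, Metric.closedBall y₀ r, isCompact_closedBall y₀ r, hball, k⟩
  let s : Finset (SeminormIndex I F V) := (Finset.range (m + 2)).image i
  have key := contDiffOn_uncurry_of_seminorm (s.sup (sectionSeminorm I F V)) hU
    Metric.isOpen_ball (convex_ball y₀ r) m (p := p) (g := fun t ↦ localRep I F V x₀ t)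
    (fun l hl ↦ ?_) (fun t₁ t₂ y hy ↦ localRep_add I F V x₀ t₁ t₂ (hsub hy))
    (fun c t y hy ↦ localRep_smul I F V x₀ c t (hsub hy))
    (fun t ↦ (contDiffOn_localRep I F V x₀ t).mono hsub) (fun k hk t y hy ↦ ?_)
  · exact (key.contDiffAt ((hU.prod Metric.isOpen_ball).mem_nhds
      ⟨hu₀, Metric.mem_ball_self hr⟩)).contDiffWithinAt
  · obtain ⟨C, hC0, hC⟩ := hl
    have hcont : Continuous l := (withSeminorms_section I F V).continuous_normedSpace_rng ℝ l
      ⟨s, ⟨C, hC0⟩, fun t ↦ hC t⟩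
    exact hp ⟨l, hcont⟩
  · refine le_trans ?_ (Seminorm.le_def.1 (Finset.le_sup (f := sectionSeminorm I F V)
      (Finset.mem_image_of_mem i (Finset.mem_range.2 (Nat.lt_succ_of_le hk)))) t)
    exact le_ciSup (bddAbove_iteratedFDeriv_localRep I F V x₀ (isCompact_closedBall y₀ r)
      hball k t) ⟨y, Metric.ball_subset_closedBall hy⟩

/-- The linear map taking a section to the `k`-th derivative of its local representative on the
compact set `K`; its sup norm is the seminorm of index `i`. -/
theorem exists_derivative_restriction (i : SeminormIndex I F V) :
    ∃ T : Cₛ^∞⟮I; F, V⟯ →ₗ[ℝ] C(i.K, E [×i.k]→L[ℝ] F),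
      ∀ s y, T s y = iteratedFDeriv ℝ i.k (localRep I F V i.x₀ s) y := by
  have hD := isOpen_localDomain I F V i.x₀
  have hsm : ∀ (s : Cₛ^∞⟮I; F, V⟯) (y : i.K), ContDiffAt ℝ i.k (localRep I F V i.x₀ s) y :=
    fun s y ↦ ((contDiffOn_localRep I F V i.x₀ s).contDiffAt
      (hD.mem_nhds (i.subset y.2))).of_le (by exact_mod_cast le_top)
  have hc : ∀ s : Cₛ^∞⟮I; F, V⟯,
      Continuous fun y : i.K ↦ iteratedFDeriv ℝ i.k (localRep I F V i.x₀ s) y := fun s ↦ by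
    have hc : ContinuousOn (iteratedFDeriv ℝ i.k (localRep I F V i.x₀ s))
        (localDomain I F V i.x₀) :=
      ((contDiffOn_localRep I F V i.x₀ s).continuousOn_iteratedFDerivWithin
        (by exact_mod_cast le_top) hD.uniqueDiffOn).congr
          fun y hy ↦ (iteratedFDerivWithin_of_isOpen i.k hD hy).symm
    exact hc.comp_continuous continuous_subtype_val fun y ↦ i.subset y.2
  refine ⟨{ toFun := fun s ↦ ⟨_, hc s⟩, map_add' := fun s t ↦ ?_, map_smul' := fun c s ↦ ?_ },
    fun s y ↦ rfl⟩
  · ext1 y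
    have hy := hD.mem_nhds (i.subset y.2)
    exact (((localRep_add I F V i.x₀ s t).eventuallyEq_of_mem hy).iteratedFDeriv ℝ i.k).eq_of_nhds
      |>.trans (iteratedFDeriv_add_apply (hsm s y) (hsm t y))
  · ext1 y
    have hy := hD.mem_nhds (i.subset y.2)
    exact (((localRep_smul I F V i.x₀ c s).eventuallyEq_of_mem hy).iteratedFDeriv ℝ i.k).eq_of_nhds
      |>.trans (iteratedFDeriv_const_smul_apply (hsm s y))

/-- A family of sections with jointly smooth local representatives is smooth against all continuous
functionals. -/
theorem contDiffOn_functional_of_contDiffOn_localRep {n : ℕ}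
    {U : Set (EuclideanSpace ℝ (Fin n))} (hU : IsOpen U)
    {p : EuclideanSpace ℝ (Fin n) → Cₛ^∞⟮I; F, V⟯}
    (hp : ∀ x₀, ContDiffOn ℝ ∞
      (fun z : EuclideanSpace ℝ (Fin n) × E ↦ localRep I F V x₀ (p z.1) z.2)
      (U ×ˢ localDomain I F V x₀))
    (l : Cₛ^∞⟮I; F, V⟯ →L[ℝ] ℝ) : ContDiffOn ℝ ∞ (fun u ↦ l (p u)) U := by
  let q : Seminorm ℝ Cₛ^∞⟮I; F, V⟯ := (normSeminorm ℝ ℝ).comp l.toLinearMap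
  have hq : Continuous q := continuous_norm.comp l.continuous
  obtain ⟨s, C, -, hC⟩ := Seminorm.bound_of_continuous (withSeminorms_section I F V) q hq
  choose T hT using exists_derivative_restriction (F := F) I V
  have (i : SeminormIndex I F V) : CompactSpace i.K := isCompact_iff_compactSpace.1 i.isCompact
  refine contDiffOn_of_bound_by_norm
    (B := fun i : s ↦ C(i.1.K, E [×i.1.k]→L[ℝ] F)) (fun i : s ↦ T i) l.toLinearMap (C := C)
    (fun t ↦ ?_) fun i ↦ ?_
  · refine (hC t).trans (mul_le_mul_of_nonneg_left ?_ C.2)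
    change s.sup (sectionSeminorm I F V) t ≤ ‖fun i : s ↦ T i t‖
    refine Seminorm.finset_sup_apply_le (norm_nonneg _) fun i hi ↦ ?_
    refine le_trans ?_ (norm_le_pi_norm (fun i : s ↦ T i t) ⟨i, hi⟩)
    refine Real.iSup_le (fun y ↦ ?_) (norm_nonneg _)
    rw [← hT]
    exact (T i t).norm_coe_le_norm y
  · have hW := hU.prod (isOpen_localDomain I F V i.1.x₀)
    have hk := contDiffOn_iteratedFDeriv_snd (𝕜 := ℝ) (f := fun u ↦ localRep I F V i.1.x₀ (p u))
      hW (hp i.1.x₀) i.1.k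
    exact contDiffOn_continuousMap_of_uncurry hU continuous_subtype_val hW
      (fun u hu y ↦ ⟨hu, i.1.subset y.2⟩) hk fun u _ y ↦ hT _ _ y

end

end

theorem proposition1p2
    {E H F M : Type*}
    [NormedAddCommGroup E] [NormedSpace ℝ E] [FiniteDimensional ℝ E]
    [TopologicalSpace H] (I : ModelWithCorners ℝ E H) [I.Boundaryless]
    [TopologicalSpace M] [T2Space M] [SecondCountableTopology M]
    [ChartedSpace H M] [IsManifold I ∞ M]
    [NormedAddCommGroup F] [NormedSpace ℝ F] [FiniteDimensional ℝ F]
    (V : M → Type*) [TopologicalSpace (TotalSpace F V)] [∀ x, TopologicalSpace (V x)]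
    [∀ x, AddCommGroup (V x)] [∀ x, Module ℝ (V x)]
    [FiberBundle F V] [VectorBundle ℝ F V] [ContMDiffVectorBundle ∞ F V I] :
    SectionDiffeology.sigmaInfty Cₛ^∞⟮I; F, V⟯ =
        SectionDiffeology.functionalDiffeologyOnSections I F V ∧
      -- the same equality of diffeologies, spelled out for plots on an open set `U ⊆ ℝⁿ`
      ∀ (n : ℕ) (U : Set (EuclideanSpace ℝ (Fin n))), IsOpen U →
        ∀ p : EuclideanSpace ℝ (Fin n) → Cₛ^∞⟮I; F, V⟯,
          (∀ l : Cₛ^∞⟮I; F, V⟯ →L[ℝ] ℝ, ContDiffOn ℝ ∞ (fun u ↦ l (p u)) U) ↔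
            ContMDiffOn (𝓘(ℝ, EuclideanSpace ℝ (Fin n)).prod I) (I.prod 𝓘(ℝ, F)) ∞
              (fun z : EuclideanSpace ℝ (Fin n) × M ↦ TotalSpace.mk' F z.2 (p z.1 z.2))
              (U ×ˢ univ) := by
  have key : ∀ (n : ℕ) (U : Set (EuclideanSpace ℝ (Fin n))), IsOpen U →
      ∀ p : EuclideanSpace ℝ (Fin n) → Cₛ^∞⟮I; F, V⟯,
        (∀ l : Cₛ^∞⟮I; F, V⟯ →L[ℝ] ℝ, ContDiffOn ℝ ∞ (fun u ↦ l (p u)) U) ↔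
          ContMDiffOn (𝓘(ℝ, EuclideanSpace ℝ (Fin n)).prod I) (I.prod 𝓘(ℝ, F)) ∞
            (fun z : EuclideanSpace ℝ (Fin n) × M ↦ TotalSpace.mk' F z.2 (p z.1 z.2))
            (U ×ˢ univ) := fun n U hU p ↦
    (⟨contDiffOn_localRep_of_contDiffOn_functional I V hU,
      contDiffOn_functional_of_contDiffOn_localRep I V hU⟩ : _ ↔ _).trans
      (contMDiffOn_transpose_iff_localRep I V hU fun u x ↦ p u x).symm
  refine ⟨?_, key⟩
  ext n p
  have h₁ := key n univ isOpen_univ p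
  simp only [univ_prod_univ, contMDiffOn_univ, contDiffOn_univ] at h₁
  exact h₁.trans (dSmooth_prod_iff_contMDiff I (I.prod 𝓘(ℝ, F)) _).symm
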